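/- Let $\triangle$ (horizontal) and $\blacktriangle$ (vertical) be two binary operation symbols. A \emph{tree monomial} of arity $n$ is a complete rooted binary plane tree with $n$ leaves whose internal nodes are labelled by $\triangle$ or $\blacktriangle$ and whose leaves are labelled bijectively by the arguments $x_1,\dots,x_n$; partial composition $q\circ_k f$ replaces the argument $k$ of $q$ by the tree $f$. Let $\equiv$ be the congruence on trees generated by associativity of both operations and the interchange law $$(a\,\triangle\, b)\,\blacktriangle\,(c\,\triangle\, d)\equiv(a\,\blacktriangle\, c)\,\triangle\,(b\,\blacktriangle\, d).$$ A tree monomial $m$ of arity $n$ satisfies the \emph{commutativity relation} for $i\neq j$ if $m\equiv m^{(ij)}$, where $m^{(ij)}$ is $m$ with the arguments $x_i,x_j$ transposed. This relation \emph{comes from a proper factor} if, using associativity of the two operations only and up to a bijective renaming of the arguments, $m$ can be rewritten as $q\circ_k f$ with $f$ of arity less than $n$, where $x_i,x_j$ are arguments of $f$ and $f\equiv f^{(ij)}$. It \emph{comes from a proper quotient} if, up to a bijective renaming of the arguments, $m=q\circ_k f$ with $q$ of arity less than $n$, where $x_i,x_j$ are arguments of $q$ other than its argument $k$ and $q\equiv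 q^{(ij)}$. The geometric realization $\Gamma(m)$ is the block partition of the open unit square $(0,1)^2$ defined recursively: a single leaf gives the undivided square; $\Gamma(m_1\triangle m_2)$ is obtained by placing $\Gamma(m_1)$ in the left half and $\Gamma(m_2)$ in the right half of the square; $\Gamma(m_1\blacktriangle m_2)$ by placing $\Gamma(m_1)$ in the bottom half and $\Gamma(m_2)$ in the top half. \textbf{Proposition.} Let $m$ be a tree monomial of arity $n$ which satisfies the commutativity relation for some $i\ne j$, and suppose that this relation comes neither from a proper factor nor from a proper quotient. Then $\Gamma(m)$ contains both main cuts: the horizontal bisection $(0,1)\times\{\tfrac12\}$ and the vertical bisection $\{\tfrac12\}\times(0,1)$ of the square both lie in the union of its cuts. That is, the interchange law can be applied at the root of $m$: if $m=m_1\ast m_2$ with root operation $\ast$, and $\ast'$ is the other operation, then by means of the interchange law alone $m_1$ can be rewritten in the form $z_1\ast' z_2$ and $m_2$ in the form $z_3\ast' z_4$. -/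

import Mathlib

namespace DoubleInterchange

/-! ### Tree monomials -/

/-- The two binary operation symbols: `white` is the horizontal operation `△`,
`black` is the vertical operation `▲`. -/
inductive Op where
  | white
  | black
  deriving DecidableEq

/-- The operation symbol different from the given one. -/
def Op.other : Op → Op
  | .white => .black
  | .black => .white

/-- Complete rooted binary plane trees with internal nodes labelled by operation symbols and
leaves labelled by elements of `α`. -/
inductive Tree (α : Type) where
  | leaf (a : α) : Tree α
  | node (o : Op) (l r : Tree α) : Tree α

namespace Tree

variable {α β : Type}

/-- The labels of the leaves, from left to right. -/
def leaves : Tree α → List α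
  | leaf a => [a]
  | node _ l r => l.leaves ++ r.leaves

/-- Simultaneous substitution of a tree for every leaf. -/
def subst (σ : α → Tree β) : Tree α → Tree β
  | leaf a => σ a
  | node o l r => node o (l.subst σ) (r.subst σ)

/-- Relabelling of the leaves. -/
def relabel (e : α → β) : Tree α → Tree β :=
  subst fun a => leaf (e a)

/-- The effect on a tree of transposing the arguments `i` and `j`. -/
def transpose [DecidableEq α] (i j : α) (t : Tree α) : Tree α :=
  t.relabel (Equiv.swap i j)

/-- Operad partial composition `q ∘ₖ f`: the tree `f` replaces the argument `k` of `q`.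
The arguments of the result are those of `q` other than `k`, together with those of `f`. -/
def partialComp [DecidableEq α] (q : Tree α) (k : α) (f : Tree β) :
    Tree ({a : α // a ≠ k} ⊕ β) :=
  q.subst fun a => if h : a = k then f.relabel Sum.inr else leaf (Sum.inl ⟨a, h⟩)

/-- The congruence (with respect to both operations) generated by a relation on trees. -/
inductive CongrGen (R : Tree α → Tree α → Prop) : Tree α → Tree α → Prop
  | of {s t : Tree α} : R s t → CongrGen R s t
  | refl (t : Tree α) : CongrGen R t t
  | symm {s t : Tree α} : CongrGen R s t → CongrGen R t s
  | trans {s t u : Tree α} : CongrGen R s t → CongrGen R t u → CongrGen R s u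
  | node (o : Op) {l l' r r' : Tree α} :
      CongrGen R l l' → CongrGen R r r' → CongrGen R (node o l r) (node o l' r')

/-- The two associative laws. -/
inductive AssocLaw : Tree α → Tree α → Prop
  | mk (o : Op) (a b c : Tree α) :
      AssocLaw (node o (node o a b) c) (node o a (node o b c))

/-- The interchange law `(a △ b) ▲ (c △ d) ≡ (a ▲ c) △ (b ▲ d)`. -/
inductive InterchangeLaw : Tree α → Tree α → Prop
  | mk (a b c d : Tree α) :
      InterchangeLaw
        (node .black (node .white a b) (node .white c d))
        (node .white (node .black a c) (node .black b d))

/-- Equality modulo associativity of both operations. -/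
def AssocEq : Tree α → Tree α → Prop := CongrGen AssocLaw

/-- Equality modulo the interchange law alone. -/
def InterEq : Tree α → Tree α → Prop := CongrGen InterchangeLaw

/-- Equality of cosets in the double interchange operad: modulo associativity of both operations
and the interchange law. -/
def DIAEq : Tree α → Tree α → Prop := CongrGen fun s t => AssocLaw s t ∨ InterchangeLaw s t

end Tree

/-- Tree monomials of arity `n`: trees whose leaves are labelled bijectively by the `n`
argument symbols. -/
structure Monomial (n : ℕ) where
  tree : Tree (Fin n)
  nodup : tree.leaves.Nodup
  mem_leaves : ∀ i, i ∈ tree.leaves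

namespace Monomial

variable {n : ℕ}

/-- The commutativity relation
`m(x₁, …, xᵢ, …, xⱼ, …, xₙ) ≡ m(x₁, …, xⱼ, …, xᵢ, …, xₙ)` holds in the double interchange
operad. -/
def CommRel (m : Monomial n) (i j : Fin n) : Prop :=
  i ≠ j ∧ Tree.DIAEq m.tree (m.tree.transpose i j)

/-- The relation transposing `i` and `j` in `m` comes from a proper factor: after reassociating
and up to naming of the arguments, `m` is `q ∘ₖ f` with `f` of arity less than `n`, and it is the
commutativity relation in `f` transposing the two corresponding arguments that is composed
with `q`. -/
def ComesFromFactor (m : Monomial n) (i j : Fin n) : Prop :=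
  ∃ (p r : ℕ) (q : Monomial p) (k : Fin p) (f : Monomial r)
    (e : {c : Fin p // c ≠ k} ⊕ Fin r ≃ Fin n) (a b : Fin r),
    r < n ∧
    Tree.AssocEq m.tree ((q.tree.partialComp k f.tree).relabel e) ∧
    e (Sum.inr a) = i ∧ e (Sum.inr b) = j ∧ f.CommRel a b

/-- The relation transposing `i` and `j` in `m` comes from a proper quotient: up to naming of the
arguments, `m` is `q ∘ₖ f` with `q` of arity less than `n` (so `f` is decomposable), and `f` is
substituted for the argument `k` in both sides of the commutativity relation in `q` transposing
the two corresponding arguments, both different from `k`. -/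
def ComesFromQuotient (m : Monomial n) (i j : Fin n) : Prop :=
  ∃ (p r : ℕ) (q : Monomial p) (k : Fin p) (f : Monomial r)
    (e : {c : Fin p // c ≠ k} ⊕ Fin r ≃ Fin n) (a b : {c : Fin p // c ≠ k}),
    p < n ∧
    m.tree = (q.tree.partialComp k f.tree).relabel e ∧
    e (Sum.inl a) = i ∧ e (Sum.inl b) = j ∧ q.CommRel a b

/-- The interchange law can be applied at the root of `m`: modulo the interchange law, the two
factors `m₁`, `m₂` of `m = m₁ ∗ m₂` are both products for the operation other than the root
operation `∗`. -/
def InterchangeAtRoot (m : Monomial n) : Prop :=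
  ∃ (o : Op) (m₁ m₂ z₁ z₂ z₃ z₄ : Tree (Fin n)),
    m.tree = .node o m₁ m₂ ∧
    Tree.InterEq m₁ (.node o.other z₁ z₂) ∧
    Tree.InterEq m₂ (.node o.other z₃ z₄)

end Monomial

/-! ### Block partitions of the open unit square -/

/-- The open unit square. -/
def unitSquare : Set (ℝ × ℝ) := Set.Ioo 0 1 ×ˢ Set.Ioo 0 1

/-- Nonempty open horizontal segments. -/
def IsHorizontal (S : Set (ℝ × ℝ)) : Prop :=
  ∃ x₁ x₂ y₀ : ℝ, x₁ < x₂ ∧ S = Set.Ioo x₁ x₂ ×ˢ {y₀}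

/-- Nonempty open vertical segments. -/
def IsVertical (S : Set (ℝ × ℝ)) : Prop :=
  ∃ x₀ y₁ y₂ : ℝ, y₁ < y₂ ∧ S = {x₀} ×ˢ Set.Ioo y₁ y₂

/-- Nonempty open rectangles with sides parallel to the axes. -/
def IsRectangle (R : Set (ℝ × ℝ)) : Prop :=
  ∃ x₁ x₂ y₁ y₂ : ℝ, x₁ < x₂ ∧ y₁ < y₂ ∧ R = Set.Ioo x₁ x₂ ×ˢ Set.Ioo y₁ y₂

/-- `C` is a finite set of horizontal and vertical cuts in the unit square, where two distinct
cuts can intersect only in one point, one being horizontal and the other vertical. -/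
structure IsCutSet (C : Set (Set (ℝ × ℝ))) : Prop where
  finite : C.Finite
  segment : ∀ S ∈ C, IsHorizontal S ∨ IsVertical S
  subset : ∀ S ∈ C, S ⊆ unitSquare
  inter : ∀ S ∈ C, ∀ T ∈ C, S ≠ T → (S ∩ T).Nonempty →
    ((IsHorizontal S ∧ IsVertical T) ∨ (IsVertical S ∧ IsHorizontal T)) ∧ ∃ z, S ∩ T = {z}

/-- A block partition of the unit square: the complement `P` in the square of the union of a set
of cuts, such that `P` is the disjoint union of finitely many open rectangles. -/
structure BlockPartition where
  carrier : Set (ℝ × ℝ)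
  exists_cuts : ∃ C, IsCutSet C ∧ carrier = unitSquare \ ⋃₀ C
  exists_blocks : ∃ B : Set (Set (ℝ × ℝ)), B.Finite ∧ (∀ R ∈ B, IsRectangle R) ∧
    B.PairwiseDisjoint id ∧ carrier = ⋃₀ B

/-- The vertical bisection of the unit square. -/
def verticalBisection : Set (ℝ × ℝ) := {1 / 2} ×ˢ Set.Ioo 0 1

/-- The horizontal bisection of the unit square. -/
def horizontalBisection : Set (ℝ × ℝ) := Set.Ioo 0 1 ×ˢ {1 / 2}

/-- The affine map of the square onto its left half. -/
noncomputable def toLeft (z : ℝ × ℝ) : ℝ × ℝ := (z.1 / 2, z.2)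

/-- The affine map of the square onto its right half. -/
noncomputable def toRight (z : ℝ × ℝ) : ℝ × ℝ := ((z.1 + 1) / 2, z.2)

/-- The affine map of the square onto its bottom half. -/
noncomputable def toBottom (z : ℝ × ℝ) : ℝ × ℝ := (z.1, z.2 / 2)

/-- The affine map of the square onto its top half. -/
noncomputable def toTop (z : ℝ × ℝ) : ℝ × ℝ := (z.1, (z.2 + 1) / 2)

/-- Maps under which block partitions of the square are transported to a half of it. -/
structure IsHalfMap (f : ℝ × ℝ → ℝ × ℝ) : Prop where
  inj : Function.Injective f
  horizontal : ∀ S, IsHorizontal S → IsHorizontal (f '' S)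
  vertical : ∀ S, IsVertical S → IsVertical (f '' S)
  rectangle : ∀ S, IsRectangle S → IsRectangle (f '' S)

theorem image_prodMap_Ioo (a b c d : ℝ) (ha : 0 < a) (hc : 0 < c) :
    IsHalfMap fun z => (a * z.1 + b, c * z.2 + d) := by
  have hI : ∀ (a b u v : ℝ), 0 < a →
      (fun x => a * x + b) '' Set.Ioo u v = Set.Ioo (a * u + b) (a * v + b) :=
    fun a b u v ha => Set.image_affine_Ioo ha b u v
  have hp : ∀ s t : Set ℝ, (fun z : ℝ × ℝ => (a * z.1 + b, c * z.2 + d)) '' s ×ˢ t =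
      ((fun x => a * x + b) '' s) ×ˢ ((fun x => c * x + d) '' t) :=
    fun s t => (Set.prod_image_image_eq (m₁ := fun x => a * x + b)
      (m₂ := fun x => c * x + d)).symm
  refine ⟨?_, ?_, ?_, ?_⟩
  · rintro ⟨x, y⟩ ⟨x', y'⟩ h
    simp only [Prod.mk.injEq, add_left_inj] at h
    exact Prod.ext (mul_left_cancel₀ ha.ne' h.1) (mul_left_cancel₀ hc.ne' h.2)
  · rintro _ ⟨x₁, x₂, y₀, h, rfl⟩
    exact ⟨a * x₁ + b, a * x₂ + b, c * y₀ + d, by nlinarith, by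
      rw [hp, hI _ _ _ _ ha, Set.image_singleton]⟩
  · rintro _ ⟨x₀, y₁, y₂, h, rfl⟩
    exact ⟨a * x₀ + b, c * y₁ + d, c * y₂ + d, by nlinarith, by
      rw [hp, hI _ _ _ _ hc, Set.image_singleton]⟩
  · rintro _ ⟨x₁, x₂, y₁, y₂, h, h', rfl⟩
    exact ⟨a * x₁ + b, a * x₂ + b, c * y₁ + d, c * y₂ + d, by nlinarith, by nlinarith, by
      rw [hp, hI _ _ _ _ ha, hI _ _ _ _ hc]⟩

theorem isHalfMap_toLeft : IsHalfMap toLeft := by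
  convert image_prodMap_Ioo (1 / 2) 0 1 0 (by norm_num) (by norm_num) using 1
  ext z <;> simp [toLeft]; ring

theorem isHalfMap_toRight : IsHalfMap toRight := by
  convert image_prodMap_Ioo (1 / 2) (1 / 2) 1 0 (by norm_num) (by norm_num) using 1
  ext z <;> simp [toRight]; ring

theorem isHalfMap_toBottom : IsHalfMap toBottom := by
  convert image_prodMap_Ioo 1 0 (1 / 2) 0 (by norm_num) (by norm_num) using 1
  ext z <;> simp [toBottom]; ring

theorem isHalfMap_toTop : IsHalfMap toTop := by
  convert image_prodMap_Ioo 1 0 (1 / 2) (1 / 2) (by norm_num) (by norm_num) using 1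
  ext z <;> simp [toTop]; ring

theorem BlockPartition.subset (P : BlockPartition) : P.carrier ⊆ unitSquare := by
  obtain ⟨C, -, h⟩ := P.exists_cuts
  rw [h]
  exact Set.sdiff_subset

theorem glue_cuts {f g : ℝ × ℝ → ℝ × ℝ} {V : Set (ℝ × ℝ)} (hf : IsHalfMap f) (hg : IsHalfMap g)
    (hV : IsHorizontal V ∨ IsVertical V)
    (hI : unitSquare = f '' unitSquare ∪ g '' unitSquare ∪ V)
    (hfg : Disjoint (f '' unitSquare) (g '' unitSquare))
    (hfV : Disjoint (f '' unitSquare) V) (hgV : Disjoint (g '' unitSquare) V)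
    (P Q : BlockPartition) :
    ∃ C, IsCutSet C ∧ f '' P.carrier ∪ g '' Q.carrier = unitSquare \ ⋃₀ C := by
  obtain ⟨C, hC, hP⟩ := P.exists_cuts
  obtain ⟨D, hD, hQ⟩ := Q.exists_cuts
  have hfs : ∀ S ∈ C, f '' S ⊆ f '' unitSquare := fun S hS => Set.image_mono (hC.subset S hS)
  have hgs : ∀ S ∈ D, g '' S ⊆ g '' unitSquare := fun S hS => Set.image_mono (hD.subset S hS)
  have no : ∀ {A B S T : Set (ℝ × ℝ)}, Disjoint A B → S ⊆ A → T ⊆ B → ¬ (S ∩ T).Nonempty :=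
    fun h hS hT hn => Set.not_disjoint_iff_nonempty_inter.2 hn (h.mono hS hT)
  refine ⟨(f '' ·) '' C ∪ (g '' ·) '' D ∪ {V}, ⟨?_, ?_, ?_, ?_⟩, ?_⟩
  · exact ((hC.finite.image _).union (hD.finite.image _)).union (Set.finite_singleton V)
  · rintro S ((⟨S, hS, rfl⟩ | ⟨S, hS, rfl⟩) | rfl)
    · exact (hC.segment S hS).imp (hf.horizontal S) (hf.vertical S)
    · exact (hD.segment S hS).imp (hg.horizontal S) (hg.vertical S)
    · exact hV
  · rintro S ((⟨S, hS, rfl⟩ | ⟨S, hS, rfl⟩) | rfl) <;> rw [hI]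
    · exact fun z hz => Or.inl (Or.inl (hfs S hS hz))
    · exact fun z hz => Or.inl (Or.inr (hgs S hS hz))
    · exact Set.subset_union_right
  · have key : ∀ {h : ℝ × ℝ → ℝ × ℝ} {E : Set (Set (ℝ × ℝ))}, IsHalfMap h → IsCutSet E →
        ∀ S ∈ E, ∀ T ∈ E, h '' S ≠ h '' T → (h '' S ∩ h '' T).Nonempty →
        ((IsHorizontal (h '' S) ∧ IsVertical (h '' T)) ∨
          (IsVertical (h '' S) ∧ IsHorizontal (h '' T))) ∧ ∃ z, h '' S ∩ h '' T = {z} := by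
      intro h E hh hE S hS T hT hne hn
      rw [← Set.image_inter hh.inj] at hn ⊢
      obtain ⟨hor, z, hz⟩ := hE.inter S hS T hT (fun e => hne (by rw [e])) hn.of_image
      exact ⟨hor.imp (fun x => ⟨hh.horizontal _ x.1, hh.vertical _ x.2⟩)
        (fun x => ⟨hh.vertical _ x.1, hh.horizontal _ x.2⟩), h z, by
          rw [hz, Set.image_singleton]⟩
    rintro S ((⟨S, hS, rfl⟩ | ⟨S, hS, rfl⟩) | rfl) T ((⟨T, hT, rfl⟩ | ⟨T, hT, rfl⟩) | rfl) hne hn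
    · exact key hf hC S hS T hT hne hn
    · exact (no hfg (hfs S hS) (hgs T hT) hn).elim
    · exact (no hfV (hfs S hS) subset_rfl hn).elim
    · exact (no hfg.symm (hgs S hS) (hfs T hT) hn).elim
    · exact key hg hD S hS T hT hne hn
    · exact (no hgV (hgs S hS) subset_rfl hn).elim
    · exact (no hfV.symm subset_rfl (hfs T hT) hn).elim
    · exact (no hgV.symm subset_rfl (hgs T hT) hn).elim
    · exact (hne rfl).elim
  · rw [Set.sUnion_union, Set.sUnion_union, Set.sUnion_singleton, ← Set.image_sUnion,
      ← Set.image_sUnion, hP, hQ, Set.image_sdiff hf.inj, Set.image_sdiff hg.inj]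
    have h1 : f '' ⋃₀ C ⊆ f '' unitSquare := Set.image_mono (Set.sUnion_subset hC.subset)
    have h2 : g '' ⋃₀ D ⊆ g '' unitSquare := Set.image_mono (Set.sUnion_subset hD.subset)
    rw [Set.disjoint_left] at hfg hfV hgV
    ext z
    have h1z := @h1 z
    have h2z := @h2 z
    have hz1 := @hfg z
    have hz2 := @hfV z
    have hz3 := @hgV z
    have hIz : z ∈ unitSquare ↔ (z ∈ f '' unitSquare ∨ z ∈ g '' unitSquare) ∨ z ∈ V := by
      conv_lhs => rw [hI]
      rfl
    simp only [Set.mem_union, Set.mem_sdiff, hIz]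
    clear hI hP hQ hfs hgs no hfg hfV hgV h1 h2
    grind

theorem glue_blocks {f g : ℝ × ℝ → ℝ × ℝ} (hf : IsHalfMap f) (hg : IsHalfMap g)
    (hfg : Disjoint (f '' unitSquare) (g '' unitSquare)) (P Q : BlockPartition) :
    ∃ B : Set (Set (ℝ × ℝ)), B.Finite ∧ (∀ R ∈ B, IsRectangle R) ∧
      B.PairwiseDisjoint id ∧ f '' P.carrier ∪ g '' Q.carrier = ⋃₀ B := by
  obtain ⟨B, hB, hr, hd, hP⟩ := P.exists_blocks
  obtain ⟨D, hD, hr', hd', hQ⟩ := Q.exists_blocks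
  have hfs : ∀ S ∈ B, f '' S ⊆ f '' unitSquare := fun S hS =>
    Set.image_mono ((Set.subset_sUnion_of_mem hS).trans (hP ▸ P.subset))
  have hgs : ∀ S ∈ D, g '' S ⊆ g '' unitSquare := fun S hS =>
    Set.image_mono ((Set.subset_sUnion_of_mem hS).trans (hQ ▸ Q.subset))
  refine ⟨(f '' ·) '' B ∪ (g '' ·) '' D, (hB.image _).union (hD.image _), ?_, ?_, ?_⟩
  · rintro R (⟨R, hR, rfl⟩ | ⟨R, hR, rfl⟩)
    · exact hf.rectangle R (hr R hR)
    · exact hg.rectangle R (hr' R hR)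
  · rintro S (⟨S, hS, rfl⟩ | ⟨S, hS, rfl⟩) T (⟨T, hT, rfl⟩ | ⟨T, hT, rfl⟩) hne
    · exact (Set.disjoint_image_iff hf.inj).2 (hd hS hT fun e => hne (by rw [e]))
    · exact hfg.mono (hfs S hS) (hgs T hT)
    · exact hfg.symm.mono (hgs S hS) (hfs T hT)
    · exact (Set.disjoint_image_iff hg.inj).2 (hd' hS hT fun e => hne (by rw [e]))
  · rw [Set.sUnion_union, ← Set.image_sUnion, ← Set.image_sUnion, hP, hQ]

theorem toLeft_unitSquare : toLeft '' unitSquare = Set.Ioo 0 (1 / 2) ×ˢ Set.Ioo 0 1 := by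
  ext ⟨x, y⟩
  simp only [toLeft, unitSquare, Set.mem_image, Set.mem_prod, Set.mem_Ioo, Prod.exists,
    Prod.mk.injEq]
  constructor
  · rintro ⟨a, b, ⟨⟨h1, h2⟩, h3⟩, rfl, rfl⟩
    exact ⟨⟨by linarith, by linarith⟩, h3⟩
  · rintro ⟨⟨h1, h2⟩, h3⟩
    exact ⟨2 * x, y, ⟨⟨by linarith, by linarith⟩, h3⟩, by ring, rfl⟩

theorem toRight_unitSquare : toRight '' unitSquare = Set.Ioo (1 / 2) 1 ×ˢ Set.Ioo 0 1 := by
  ext ⟨x, y⟩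
  simp only [toRight, unitSquare, Set.mem_image, Set.mem_prod, Set.mem_Ioo, Prod.exists,
    Prod.mk.injEq]
  constructor
  · rintro ⟨a, b, ⟨⟨h1, h2⟩, h3⟩, rfl, rfl⟩
    exact ⟨⟨by linarith, by linarith⟩, h3⟩
  · rintro ⟨⟨h1, h2⟩, h3⟩
    exact ⟨2 * x - 1, y, ⟨⟨by linarith, by linarith⟩, h3⟩, by ring, rfl⟩

theorem toBottom_unitSquare : toBottom '' unitSquare = Set.Ioo 0 1 ×ˢ Set.Ioo 0 (1 / 2) := by
  ext ⟨x, y⟩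
  simp only [toBottom, unitSquare, Set.mem_image, Set.mem_prod, Set.mem_Ioo, Prod.exists,
    Prod.mk.injEq]
  constructor
  · rintro ⟨a, b, ⟨h3, ⟨h1, h2⟩⟩, rfl, rfl⟩
    exact ⟨h3, ⟨by linarith, by linarith⟩⟩
  · rintro ⟨h3, ⟨h1, h2⟩⟩
    exact ⟨x, 2 * y, ⟨h3, ⟨by linarith, by linarith⟩⟩, rfl, by ring⟩

theorem toTop_unitSquare : toTop '' unitSquare = Set.Ioo 0 1 ×ˢ Set.Ioo (1 / 2) 1 := by
  ext ⟨x, y⟩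
  simp only [toTop, unitSquare, Set.mem_image, Set.mem_prod, Set.mem_Ioo, Prod.exists,
    Prod.mk.injEq]
  constructor
  · rintro ⟨a, b, ⟨h3, ⟨h1, h2⟩⟩, rfl, rfl⟩
    exact ⟨h3, ⟨by linarith, by linarith⟩⟩
  · rintro ⟨h3, ⟨h1, h2⟩⟩
    exact ⟨x, 2 * y - 1, ⟨h3, ⟨by linarith, by linarith⟩⟩, rfl, by ring⟩

theorem Ioo_eq_halves : Set.Ioo (0 : ℝ) 1 = Set.Ioo 0 (1 / 2) ∪ Set.Ioo (1 / 2) 1 ∪ {1 / 2} := by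
  ext x
  simp only [Set.mem_Ioo, Set.mem_union, Set.mem_singleton_iff]
  constructor
  · rintro ⟨h1, h2⟩
    rcases lt_trichotomy x (1 / 2) with h | h | h
    · exact Or.inl (Or.inl ⟨h1, h⟩)
    · exact Or.inr h
    · exact Or.inl (Or.inr ⟨h, h2⟩)
  · rintro ((⟨h1, h2⟩ | ⟨h1, h2⟩) | rfl) <;> constructor <;> linarith

theorem disjoint_halves : Disjoint (Set.Ioo (0 : ℝ) (1 / 2)) (Set.Ioo (1 / 2) 1) :=
  Set.disjoint_left.2 fun _ h h' => lt_asymm h.2 h'.1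

theorem disjoint_half_left : Disjoint (Set.Ioo (0 : ℝ) (1 / 2)) {1 / 2} :=
  Set.disjoint_singleton_right.2 fun h => lt_irrefl _ h.2

theorem disjoint_half_right : Disjoint (Set.Ioo (1 / 2 : ℝ) 1) {1 / 2} :=
  Set.disjoint_singleton_right.2 fun h => lt_irrefl _ h.1

namespace BlockPartition

/-- The unit square itself, the block partition with one part. -/
def unit : BlockPartition where
  carrier := unitSquare
  exists_cuts := ⟨∅, ⟨Set.finite_empty, by simp, by simp, by simp⟩, by simp⟩
  exists_blocks := ⟨{unitSquare}, Set.finite_singleton _, by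
    rintro R rfl
    exact ⟨0, 1, 0, 1, one_pos, one_pos, rfl⟩, Set.pairwiseDisjoint_singleton _ _, by simp⟩

/-- The horizontal operation `P → Q`: the translate of `Q` one unit to the east is united with `P`
and the resulting partition is scaled horizontally by one half. -/
noncomputable def hop (P Q : BlockPartition) : BlockPartition where
  carrier := toLeft '' P.carrier ∪ toRight '' Q.carrier
  exists_cuts := by
    refine glue_cuts (V := verticalBisection) isHalfMap_toLeft isHalfMap_toRight
      (Or.inr ⟨1 / 2, 0, 1, one_pos, rfl⟩) ?_ ?_ ?_ ?_ P Q
    · rw [toLeft_unitSquare, toRight_unitSquare, verticalBisection, unitSquare,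
        ← Set.union_prod, ← Set.union_prod, ← Ioo_eq_halves]
    · rw [toLeft_unitSquare, toRight_unitSquare]
      exact Set.disjoint_prod.2 (Or.inl disjoint_halves)
    · rw [toLeft_unitSquare]
      exact Set.disjoint_prod.2 (Or.inl disjoint_half_left)
    · rw [toRight_unitSquare]
      exact Set.disjoint_prod.2 (Or.inl disjoint_half_right)
  exists_blocks := by
    refine glue_blocks isHalfMap_toLeft isHalfMap_toRight ?_ P Q
    rw [toLeft_unitSquare, toRight_unitSquare]
    exact Set.disjoint_prod.2 (Or.inl disjoint_halves)

/-- The vertical operation `P ↑ Q`: the translate of `Q` one unit to the north is united with `P`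
and the resulting partition is scaled vertically by one half. -/
noncomputable def vop (P Q : BlockPartition) : BlockPartition where
  carrier := toBottom '' P.carrier ∪ toTop '' Q.carrier
  exists_cuts := by
    refine glue_cuts (V := horizontalBisection) isHalfMap_toBottom isHalfMap_toTop
      (Or.inl ⟨0, 1, 1 / 2, one_pos, rfl⟩) ?_ ?_ ?_ ?_ P Q
    · rw [toBottom_unitSquare, toTop_unitSquare, horizontalBisection, unitSquare,
        ← Set.prod_union, ← Set.prod_union, ← Ioo_eq_halves]
    · rw [toBottom_unitSquare, toTop_unitSquare]
      exact Set.disjoint_prod.2 (Or.inr disjoint_halves)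
    · rw [toBottom_unitSquare]
      exact Set.disjoint_prod.2 (Or.inr disjoint_half_left)
    · rw [toTop_unitSquare]
      exact Set.disjoint_prod.2 (Or.inr disjoint_half_right)
  exists_blocks := by
    refine glue_blocks isHalfMap_toBottom isHalfMap_toTop ?_ P Q
    rw [toBottom_unitSquare, toTop_unitSquare]
    exact Set.disjoint_prod.2 (Or.inr disjoint_halves)

/-- `P` contains the horizontal main cut: the horizontal bisection of the square lies in the union
of the cuts, that is, in the complement of the union of the empty blocks. -/
def HasHorizontalMainCut (P : BlockPartition) : Prop :=
  horizontalBisection ⊆ unitSquare \ P.carrier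

/-- `P` contains the vertical main cut. -/
def HasVerticalMainCut (P : BlockPartition) : Prop :=
  verticalBisection ⊆ unitSquare \ P.carrier

end BlockPartition

/-- The geometric realization of a tree, without the labels of the blocks. -/
noncomputable def Tree.realization {α : Type} : Tree α → BlockPartition
  | .leaf _ => .unit
  | .node .white l r => .hop l.realization r.realization
  | .node .black l r => .vop l.realization r.realization

/-- The dyadic block partition of the square corresponding to a tree monomial. -/
noncomputable def Monomial.realization {n : ℕ} (m : Monomial n) : BlockPartition :=
  m.tree.realization

end DoubleInterchange

namespace DoubleInterchange

namespace Tree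

variable {α β γ : Type}

/-! ### Substitution and relabelling -/

/-! Call the maximal subtrees of `t` not rooted at `o`, reached from the root through `o`-nodes
only, the `o`-factors of `t`. Everything depends on whether some `o`-factor is a single leaf.

Suppose the leaf `a` is an `o`-factor, so that `t` is `x o a o y` up to associativity, with `x` or
`y` possibly absent (hence the `Option`s). Interchange only acts on factors that are products for
the other operation, so no rewriting moves anything across `a`: the cosets of `x` and `y` are
invariants of the coset of `t` (`cosetSplitAt_eq`). Applied to `m ≡ m^(ij)`, this shows that the
transposition fixes `a` and preserves the cosets of `x` and `y` separately
(`splitAt_of_diaEq_relabel`). Thus `i` and `j` lie together in `x` or in `y`, and the relation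
already holds in that factor, which is proper because it misses `a` (`comesFromFactor_of_splitAt`).

Hence under the hypotheses no leaf is a factor for either operation. Every △-factor is then a
▲-product, which carries the horizontal bisection, and these bisections line up across the
△-product; the vertical cut is symmetric. The same induction, with interchange in place of the
alignment of cuts, gives the algebraic form (`exists_interEq_of_splitAt_eq_none`). -/

theorem subst_congr {σ τ : α → Tree β} {t : Tree α} (h : ∀ a ∈ t.leaves, σ a = τ a) :
    t.subst σ = t.subst τ := by
  induction t with
  | leaf a => exact h a (by simp [leaves])
  | node o l r ihl ihr =>
    simp only [subst]
    rw [ihl fun a ha => h a (by simp [leaves, ha]), ihr fun a ha => h a (by simp [leaves, ha])]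

theorem subst_leaf (t : Tree α) : t.subst leaf = t := by
  induction t with
  | leaf a => rfl
  | node o l r ihl ihr => simp only [subst, ihl, ihr]

theorem subst_subst (σ : α → Tree β) (τ : β → Tree γ) (t : Tree α) :
    (t.subst σ).subst τ = t.subst fun a => (σ a).subst τ := by
  induction t with
  | leaf a => rfl
  | node o l r ihl ihr => simp only [subst, ihl, ihr]

theorem leaves_subst (σ : α → Tree β) (t : Tree α) :
    (t.subst σ).leaves = t.leaves.flatMap fun a => (σ a).leaves := by
  induction t with
  | leaf a => simp [subst, leaves]
  | node o l r ihl ihr => simp [subst, leaves, ihl, ihr]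

theorem leaves_relabel (e : α → β) (t : Tree α) : (t.relabel e).leaves = t.leaves.map e := by
  induction t with
  | leaf a => rfl
  | node o l r ihl ihr =>
    change (l.relabel e).leaves ++ (r.relabel e).leaves = _
    simp [leaves, ihl, ihr]

theorem relabel_relabel (e : α → β) (g : β → γ) (t : Tree α) :
    (t.relabel e).relabel g = t.relabel (g ∘ e) :=
  subst_subst _ _ t

theorem relabel_congr {e g : α → β} {t : Tree α} (h : ∀ a ∈ t.leaves, e a = g a) :
    t.relabel e = t.relabel g :=
  subst_congr fun a ha => by rw [h a ha]

theorem relabel_eq_self {e : α → α} {t : Tree α} (h : ∀ a ∈ t.leaves, e a = a) :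
    t.relabel e = t :=
  (subst_congr fun a ha => by rw [h a ha]).trans (subst_leaf t)

/-! ### Congruences -/

theorem CongrGen.mono {R S : Tree α → Tree α → Prop} (h : ∀ s t, R s t → S s t) {s t : Tree α}
    (hst : CongrGen R s t) : CongrGen S s t := by
  induction hst with
  | of hr => exact .of (h _ _ hr)
  | refl t => exact .refl t
  | symm _ ih => exact ih.symm
  | trans _ _ ih₁ ih₂ => exact ih₁.trans ih₂
  | node o _ _ ih₁ ih₂ => exact .node o ih₁ ih₂

theorem AssocEq.diaEq {s t : Tree α} (h : AssocEq s t) : DIAEq s t :=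
  CongrGen.mono (fun _ _ => Or.inl) h

theorem assocEq_assoc (o : Op) (a b c : Tree α) :
    AssocEq (node o (node o a b) c) (node o a (node o b c)) :=
  .of (.mk o a b c)

/-- Associativity keeps the order of the leaves; interchange swaps the two middle blocks. -/
theorem DIAEq.leaves_perm {s t : Tree α} (h : DIAEq s t) : s.leaves.Perm t.leaves := by
  induction h with
  | of hr =>
    rcases hr with ⟨o, a, b, c⟩ | ⟨a, b, c, d⟩
    · simp [leaves]
    · simp only [leaves, List.append_assoc]
      refine List.Perm.append_left _ ?_
      rw [← List.append_assoc, ← List.append_assoc]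
      exact List.perm_append_comm.append_right _
  | refl t => exact .refl _
  | symm _ ih => exact ih.symm
  | trans _ _ ih₁ ih₂ => exact ih₁.trans ih₂
  | node o _ _ ih₁ ih₂ => exact ih₁.append ih₂

/-- The laws do not see labels, so no injectivity is needed; this allows a relabelling that is
injective only on the leaves that occur. -/
theorem DIAEq.relabel (e : α → β) {s t : Tree α} (h : DIAEq s t) :
    DIAEq (s.relabel e) (t.relabel e) := by
  induction h with
  | of hr =>
    rcases hr with ⟨o, a, b, c⟩ | ⟨a, b, c, d⟩
    · exact .of (.inl (.mk o _ _ _))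
    · exact .of (.inr (.mk _ _ _ _))
  | refl t => exact .refl _
  | symm _ ih => exact ih.symm
  | trans _ _ ih₁ ih₂ => exact ih₁.trans ih₂
  | node o _ _ ih₁ ih₂ => exact .node o ih₁ ih₂

/-! ### Splitting a product at a leaf factor -/

/-- The product of two possibly empty trees. -/
def join (o : Op) : Option (Tree α) → Option (Tree α) → Option (Tree α)
  | none, y => y
  | some x, none => some x
  | some x, some y => some (node o x y)

/-- The leaves of a possibly empty tree. -/
def leavesOption (x : Option (Tree α)) : List α :=
  x.elim [] leaves

theorem leavesOption_some (x : Tree α) : leavesOption (some x) = x.leaves :=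
  rfl

theorem leavesOption_join (o : Op) (x y : Option (Tree α)) :
    leavesOption (join o x y) = leavesOption x ++ leavesOption y := by
  rcases x with _ | x <;> rcases y with _ | y <;> simp [join, leavesOption, leaves]

/-- The setoid of equality in the double interchange operad. -/
def diaSetoid (α : Type) : Setoid (Tree α) :=
  ⟨DIAEq, .refl, .symm, .trans⟩

/-- The coset of a possibly empty tree. -/
def optionCoset (x : Option (Tree α)) : Option (Quotient (diaSetoid α)) :=
  x.map (Quotient.mk _)

theorem optionCoset_some {x y : Tree α} :
    optionCoset (some x) = optionCoset (some y) ↔ DIAEq x y :=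
  Option.some_inj.trans Quotient.eq

theorem optionCoset_join {o : Op} {x x' y y' : Option (Tree α)}
    (hx : optionCoset x = optionCoset x') (hy : optionCoset y = optionCoset y') :
    optionCoset (join o x y) = optionCoset (join o x' y') := by
  rcases x with _ | x <;> rcases x' with _ | x'
  · exact hy
  · cases hx
  · cases hx
  · rcases y with _ | y <;> rcases y' with _ | y'
    · exact hx
    · cases hy
    · cases hy
    · exact optionCoset_some.2 (.node o (optionCoset_some.1 hx) (optionCoset_some.1 hy))

theorem optionCoset_join_assoc (o : Op) (x y z : Option (Tree α)) :
    optionCoset (join o (join o x y) z) = optionCoset (join o x (join o y z)) := by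
  rcases x with _ | x <;> rcases y with _ | y <;> rcases z with _ | z <;> try rfl
  exact optionCoset_some.2 (assocEq_assoc o x y z).diaEq

theorem leavesOption_perm {x y : Option (Tree α)} (h : optionCoset x = optionCoset y) :
    (leavesOption x).Perm (leavesOption y) := by
  rcases x with _ | x <;> rcases y with _ | y
  · rfl
  · cases h
  · cases h
  · exact (optionCoset_some.1 h).leaves_perm

/-- If the leaf `a` is one of the factors of `t` as an iterated product for the operation `o`,
then `splitAt o a t` consists of the products of the factors to the left and to the right of the
first such leaf; otherwise `splitAt o a t` is `none`. -/
def splitAt [DecidableEq α] (o : Op) (a : α) :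
    Tree α → Option (Option (Tree α) × Option (Tree α))
  | leaf b => if b = a then some (none, none) else none
  | node o' l r =>
    if o' = o then
      match l.splitAt o a with
      | some p => some (p.1, join o p.2 (some r))
      | none => (r.splitAt o a).map fun p => (join o (some l) p.1, p.2)
    else none

section splitAt

variable [DecidableEq α]

theorem splitAt_node_self (o : Op) (a : α) (l r : Tree α) :
    (node o l r).splitAt o a =
      match l.splitAt o a with
      | some p => some (p.1, join o p.2 (some r))
      | none => (r.splitAt o a).map fun p => (join o (some l) p.1, p.2) :=
  if_pos rfl

theorem splitAt_node_of_ne {o o' : Op} (h : o' ≠ o) (a : α) (l r : Tree α) :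
    (node o' l r).splitAt o a = none :=
  if_neg h

theorem splitAt_node_eq_some {o o' : Op} {a : α} {l r : Tree α}
    {p : Option (Tree α) × Option (Tree α)} (h : (node o' l r).splitAt o a = some p) :
    o' = o ∧ ((∃ p', l.splitAt o a = some p' ∧ p = (p'.1, join o p'.2 (some r))) ∨
      ∃ p', r.splitAt o a = some p' ∧ p = (join o (some l) p'.1, p'.2)) := by
  by_cases ho : o' = o
  · subst ho
    refine ⟨rfl, ?_⟩
    rw [splitAt_node_self] at h
    cases hl : l.splitAt o' a with
    | some p' =>
      rw [hl] at h
      exact .inl ⟨p', rfl, (Option.some.inj h).symm⟩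
    | none =>
      rw [hl] at h
      obtain ⟨p', hp', rfl⟩ := Option.map_eq_some_iff.1 h
      exact .inr ⟨p', hp', rfl⟩
  · rw [splitAt_node_of_ne ho] at h
    cases h

theorem splitAt_node_self_eq_none {o : Op} {a : α} {l r : Tree α}
    (h : (node o l r).splitAt o a = none) : l.splitAt o a = none ∧ r.splitAt o a = none := by
  rw [splitAt_node_self] at h
  cases hl : l.splitAt o a with
  | some p => simp [hl] at h
  | none => simpa [hl] using h

/-- The position of the leaf factor can be read off from the size of the left side; this is what
later identifies `e a` with `a`. -/
theorem leaves_of_splitAt {o : Op} {a : α} {t : Tree α} {p : Option (Tree α) × Option (Tree α)}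
    (h : t.splitAt o a = some p) : t.leaves = leavesOption p.1 ++ a :: leavesOption p.2 := by
  induction t generalizing p with
  | leaf b =>
    by_cases hb : b = a
    · simp only [splitAt, if_pos hb, Option.some.injEq] at h
      subst h
      simp [leaves, leavesOption, hb]
    · simp [splitAt, hb] at h
  | node o' l r ihl ihr =>
    obtain ⟨-, ⟨p', hp', rfl⟩ | ⟨p', hp', rfl⟩⟩ := splitAt_node_eq_some h
    · simp [leaves, ihl hp', leavesOption_join, leavesOption_some]
    · simp [leaves, ihr hp', leavesOption_join, leavesOption_some]

/-- Associativity gathers everything left of the leaf into one factor; `z` collects the rest,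
including the leaf itself. -/
theorem exists_assocEq_of_splitAt_fst {o : Op} {a : α} {t x : Tree α} {y : Option (Tree α)}
    (h : t.splitAt o a = some (some x, y)) : ∃ z, AssocEq t (node o x z) := by
  induction t generalizing x y with
  | leaf b =>
    by_cases hb : b = a <;> simp [splitAt, hb] at h
  | node o' l r ihl ihr =>
    obtain ⟨rfl, ⟨⟨x', y'⟩, hp', hp⟩ | ⟨⟨x', y'⟩, hp', hp⟩⟩ := splitAt_node_eq_some h
    · obtain ⟨rfl, rfl⟩ := Prod.mk.inj hp
      obtain ⟨z, hz⟩ := ihl hp'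
      exact ⟨node o' z r, (CongrGen.node o' hz (.refl r)).trans (assocEq_assoc o' _ _ _)⟩
    · obtain ⟨hx, rfl⟩ := Prod.mk.inj hp
      rcases x' with _ | x'
      · cases hx
        exact ⟨r, .refl _⟩
      · cases hx
        obtain ⟨z, hz⟩ := ihr hp'
        exact ⟨z, (CongrGen.node o' (.refl l) hz).trans (assocEq_assoc o' _ _ _).symm⟩

theorem exists_assocEq_of_splitAt_snd {o : Op} {a : α} {t y : Tree α} {x : Option (Tree α)}
    (h : t.splitAt o a = some (x, some y)) : ∃ z, AssocEq t (node o z y) := by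
  induction t generalizing x y with
  | leaf b =>
    by_cases hb : b = a <;> simp [splitAt, hb] at h
  | node o' l r ihl ihr =>
    obtain ⟨rfl, ⟨⟨x', y'⟩, hp', hp⟩ | ⟨⟨x', y'⟩, hp', hp⟩⟩ := splitAt_node_eq_some h
    · obtain ⟨rfl, hy⟩ := Prod.mk.inj hp
      rcases y' with _ | y'
      · cases hy
        exact ⟨l, .refl _⟩
      · cases hy
        obtain ⟨z, hz⟩ := ihl hp'
        exact ⟨z, (CongrGen.node o' hz (.refl r)).trans (assocEq_assoc o' _ _ _)⟩
    · obtain ⟨rfl, rfl⟩ := Prod.mk.inj hp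
      obtain ⟨z, hz⟩ := ihr hp'
      exact ⟨node o' l z, (CongrGen.node o' (.refl l) hz).trans (assocEq_assoc o' _ _ _).symm⟩

/-- Injectivity ensures that no other label becomes `e a`, so the search stops at the same leaf. -/
theorem splitAt_relabel [DecidableEq β] {e : α → β} (he : Function.Injective e) (o : Op) (a : α)
    (t : Tree α) : (t.relabel e).splitAt o (e a) =
      (t.splitAt o a).map (Prod.map (Option.map (relabel e)) (Option.map (relabel e))) := by
  have hj : ∀ x y : Option (Tree α), (join o x y).map (relabel e) =
      join o (x.map (relabel e)) (y.map (relabel e)) := by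
    rintro (_ | x) (_ | y) <;> rfl
  induction t with
  | leaf b =>
    change (leaf (e b)).splitAt o (e a) = _
    by_cases hb : b = a
    · simp [splitAt, hb]
    · simp [splitAt, hb, he.eq_iff]
  | node o' l r ihl ihr =>
    change (node o' (l.relabel e) (r.relabel e)).splitAt o (e a) = _
    by_cases ho : o' = o
    · subst ho
      rw [splitAt_node_self, splitAt_node_self, ihl, ihr]
      cases l.splitAt o' a with
      | some p => simp [hj]
      | none => cases r.splitAt o' a <;> simp [hj]
    · rw [splitAt_node_of_ne ho, splitAt_node_of_ne ho]
      rfl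

/-! ### Invariance of the splitting -/

/-- The cosets of the two sides of a splitting. -/
def cosetSplitAt (o : Op) (a : α) (t : Tree α) :
    Option (Option (Quotient (diaSetoid α)) × Option (Quotient (diaSetoid α))) :=
  (t.splitAt o a).map (Prod.map optionCoset optionCoset)

/-- Agreement of the splittings of the children is not enough: the child without the leaf is
absorbed whole into one side, so its own coset must be preserved too. -/
theorem cosetSplitAt_node_congr (o o' : Op) (a : α) {l l' r r' : Tree α} (hl : DIAEq l l')
    (hr : DIAEq r r') (ihl : cosetSplitAt o a l = cosetSplitAt o a l')
    (ihr : cosetSplitAt o a r = cosetSplitAt o a r') :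
    cosetSplitAt o a (node o' l r) = cosetSplitAt o a (node o' l' r') := by
  unfold cosetSplitAt at *
  by_cases ho : o' = o
  · subst ho
    rw [splitAt_node_self, splitAt_node_self]
    revert ihl ihr
    rcases l.splitAt o' a with _ | ⟨x, y⟩ <;> rcases l'.splitAt o' a with _ | ⟨x', y'⟩
    · rcases r.splitAt o' a with _ | ⟨z, w⟩ <;> rcases r'.splitAt o' a with _ | ⟨z', w'⟩ <;>
        intro _ ihr <;> simp at ihr ⊢
      exact ⟨optionCoset_join (optionCoset_some.2 hl) ihr.1, ihr.2⟩
    · simp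
    · simp
    · intro ihl _
      simp at ihl ⊢
      exact ⟨ihl.1, optionCoset_join ihl.2 (optionCoset_some.2 hr)⟩
  · rw [splitAt_node_of_ne ho, splitAt_node_of_ne ho]

/-- Associativity only rebrackets the factors on either side of the leaf, and interchange never
applies at a node having a leaf factor for its operation. -/
theorem cosetSplitAt_eq {s t : Tree α} (h : DIAEq s t) (o : Op) (a : α) :
    cosetSplitAt o a s = cosetSplitAt o a t := by
  induction h with
  | of hr =>
    unfold cosetSplitAt
    rcases hr with ⟨o', u, v, w⟩ | ⟨u, v, w, z⟩
    · by_cases ho : o' = o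
      · subst ho
        simp only [splitAt_node_self]
        rcases u.splitAt o' a with _ | ⟨x, y⟩
        · rcases v.splitAt o' a with _ | ⟨x, y⟩
          · rcases w.splitAt o' a with _ | ⟨x, y⟩
            · rfl
            · simpa [join] using optionCoset_join_assoc o' (some u) (some v) x
          · simp
        · simpa [join] using optionCoset_join_assoc o' y (some v) (some w)
      · simp only [splitAt_node_of_ne ho]
    -- On both sides of the interchange law the children of the root are products for the other
    -- operation, so neither side has a leaf factor.
    · cases o <;> simp [splitAt]
  | refl t => rfl
  | symm _ ih => exact ih.symm
  | trans _ _ ih₁ ih₂ => exact ih₁.trans ih₂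
  | node o' hl hr ihl ihr => exact cosetSplitAt_node_congr o o' a hl hr ihl ihr

/-- A leaf factor is fixed by every permutation of the labels that preserves the coset of the
tree, and the permutation also preserves the cosets of the two sides of the leaf. -/
theorem splitAt_of_diaEq_relabel {e : α → α} (he : Function.Injective e) {o : Op} {a : α}
    {t : Tree α} {x y : Option (Tree α)} (ht : DIAEq t (t.relabel e))
    (h : t.splitAt o a = some (x, y)) :
    e a = a ∧ optionCoset x = optionCoset (x.map (relabel e)) ∧
      optionCoset y = optionCoset (y.map (relabel e)) := by
  have h₁ := splitAt_relabel he o a t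
  rw [h] at h₁
  have hc := cosetSplitAt_eq ht o a
  unfold cosetSplitAt at hc
  rw [h] at hc
  obtain ⟨⟨x', y'⟩, h₂, hxy⟩ := Option.map_eq_some_iff.1 hc.symm
  obtain ⟨hx, hy⟩ := Prod.mk.inj hxy
  -- The relabelled tree splits at `a` by invariance and at `e a` by transport. The left sides have
  -- equal size, so both leaves occupy the same position in one list.
  have hlen : (leavesOption x').length = (leavesOption (x.map (relabel e))).length := by
    rw [(leavesOption_perm hx).length_eq]
    rcases x with _ | x
    · rfl
    · simp [leavesOption, leaves_relabel]
  have hea : a = e a := (List.cons.inj (List.append_inj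
    ((leaves_of_splitAt h₂).symm.trans (leaves_of_splitAt h₁)) hlen).2).1
  rw [← hea, h₂] at h₁
  obtain ⟨rfl, rfl⟩ := Prod.mk.inj (Option.some.inj h₁)
  exact ⟨hea.symm, hx.symm, hy.symm⟩

/-! ### Products without leaf factors -/

/-- A product for `o` without leaf factors can be rewritten, by means of the interchange law
alone, as a product for the other operation. -/
theorem exists_interEq_of_splitAt_eq_none {o : Op} {t : Tree α}
    (h : ∀ a, t.splitAt o a = none) : ∃ z₁ z₂, InterEq t (node o.other z₁ z₂) := by
  induction t with
  | leaf b => simpa [splitAt] using h b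
  | node o' l r ihl ihr =>
    by_cases ho : o' = o
    · subst ho
      obtain ⟨z₁, z₂, hz⟩ := ihl fun a => (splitAt_node_self_eq_none (h a)).1
      obtain ⟨w₁, w₂, hw⟩ := ihr fun a => (splitAt_node_self_eq_none (h a)).2
      -- Both children are now products for the other operation, so interchange applies at this
      -- node; its direction depends on `o'`.
      refine ⟨node o' z₁ w₁, node o' z₂ w₂, (CongrGen.node o' hz hw).trans ?_⟩
      cases o'
      · exact (CongrGen.of (.mk _ _ _ _)).symm
      · exact .of (.mk _ _ _ _)
    · refine ⟨l, r, ?_⟩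
      have : o' = o.other := by cases o <;> cases o' <;> first | rfl | exact absurd rfl ho
      rw [this]
      exact .refl _

end splitAt

end Tree

/-! ### Main cuts -/

namespace BlockPartition

/-- The two halves are images of subsets of the open square, so neither reaches the line between
them. -/
theorem hop_hasVerticalMainCut (P Q : BlockPartition) : (P.hop Q).HasVerticalMainCut := by
  rintro ⟨x, y⟩ ⟨hx, hy⟩
  obtain rfl : x = 1 / 2 := hx
  refine ⟨⟨⟨by norm_num, by norm_num⟩, hy⟩, ?_⟩
  rintro (⟨⟨u, v⟩, hz, he⟩ | ⟨⟨u, v⟩, hz, he⟩)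
  · have h1 : u / 2 = 1 / 2 := congrArg Prod.fst he
    have h2 : u < 1 := (P.subset hz).1.2
    linarith
  · have h1 : (u + 1) / 2 = 1 / 2 := congrArg Prod.fst he
    have h2 : 0 < u := (Q.subset hz).1.1
    linarith

theorem vop_hasHorizontalMainCut (P Q : BlockPartition) : (P.vop Q).HasHorizontalMainCut := by
  rintro ⟨x, y⟩ ⟨hx, hy⟩
  obtain rfl : y = 1 / 2 := hy
  refine ⟨⟨hx, ⟨by norm_num, by norm_num⟩⟩, ?_⟩
  rintro (⟨⟨u, v⟩, hz, he⟩ | ⟨⟨u, v⟩, hz, he⟩)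
  · have h1 : v / 2 = 1 / 2 := congrArg Prod.snd he
    have h2 : v < 1 := (P.subset hz).2.2
    linarith
  · have h1 : (v + 1) / 2 = 1 / 2 := congrArg Prod.snd he
    have h2 : 0 < v := (Q.subset hz).2.1
    linarith

/-- A point of the bisection covered by either half would pull back to a point on the bisection of
that half; the centre needs no separate case, since neither image contains it. -/
theorem HasHorizontalMainCut.hop {P Q : BlockPartition} (hP : P.HasHorizontalMainCut)
    (hQ : Q.HasHorizontalMainCut) : (P.hop Q).HasHorizontalMainCut := by
  rintro ⟨x, y⟩ ⟨hx, hy⟩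
  obtain rfl : y = 1 / 2 := hy
  refine ⟨⟨hx, ⟨by norm_num, by norm_num⟩⟩, ?_⟩
  rintro (⟨⟨u, v⟩, hz, he⟩ | ⟨⟨u, v⟩, hz, he⟩)
  · exact (hP (a := (u, v)) ⟨(P.subset hz).1, congrArg Prod.snd he⟩).2 hz
  · exact (hQ (a := (u, v)) ⟨(Q.subset hz).1, congrArg Prod.snd he⟩).2 hz

theorem HasVerticalMainCut.vop {P Q : BlockPartition} (hP : P.HasVerticalMainCut)
    (hQ : Q.HasVerticalMainCut) : (P.vop Q).HasVerticalMainCut := by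
  rintro ⟨x, y⟩ ⟨hx, hy⟩
  obtain rfl : x = 1 / 2 := hx
  refine ⟨⟨⟨by norm_num, by norm_num⟩, hy⟩, ?_⟩
  rintro (⟨⟨u, v⟩, hz, he⟩ | ⟨⟨u, v⟩, hz, he⟩)
  · exact (hP (a := (u, v)) ⟨congrArg Prod.fst he, (P.subset hz).2⟩).2 hz
  · exact (hQ (a := (u, v)) ⟨congrArg Prod.fst he, (Q.subset hz).2⟩).2 hz

end BlockPartition

namespace Tree

variable {α : Type} [DecidableEq α]

/-- Among the △-factors only a leaf lacks the horizontal cut: ▲-products have it, and △-products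
inherit it. -/
theorem hasHorizontalMainCut_of_splitAt_eq_none {t : Tree α}
    (h : ∀ a, t.splitAt .white a = none) : t.realization.HasHorizontalMainCut := by
  induction t with
  | leaf b => simpa [splitAt] using h b
  | node o l r ihl ihr =>
    cases o
    · exact (ihl fun a => (splitAt_node_self_eq_none (h a)).1).hop
        (ihr fun a => (splitAt_node_self_eq_none (h a)).2)
    · exact BlockPartition.vop_hasHorizontalMainCut _ _

theorem hasVerticalMainCut_of_splitAt_eq_none {t : Tree α}
    (h : ∀ a, t.splitAt .black a = none) : t.realization.HasVerticalMainCut := by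
  induction t with
  | leaf b => simpa [splitAt] using h b
  | node o l r ihl ihr =>
    cases o
    · exact BlockPartition.hop_hasVerticalMainCut _ _
    · exact (ihl fun a => (splitAt_node_self_eq_none (h a)).1).vop
        (ihr fun a => (splitAt_node_self_eq_none (h a)).2)

end Tree

/-! ### Commutativity relations coming from a factor -/

open DoubleInterchange.Tree

namespace Monomial

variable {n : ℕ}

/-- A commutativity relation in `x` gives one that comes from a proper factor in every monomial
which is, up to associativity, the result of replacing the leaf `none` of `c` by `x`. -/
theorem comesFromFactor_of_assocEq_subst (m : Monomial n) {i j : Fin n} (hij : i ≠ j)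
    {x : Tree (Fin n)} (hi : i ∈ x.leaves) (hj : j ∈ x.leaves) (hx : DIAEq x (x.transpose i j))
    (hlt : ∃ a, a ∉ x.leaves) {c : Tree (Option (Fin n))} {l : List (Fin n)}
    (hc : c.leaves.Perm (none :: l.map some))
    (h : AssocEq m.tree (c.subst fun b => b.elim x leaf)) : m.ComesFromFactor i j := by
  classical
  have hperm : m.tree.leaves.Perm (x.leaves ++ l) := by
    refine h.diaEq.leaves_perm.trans ?_
    rw [leaves_subst]
    refine (hc.flatMap_right _).trans (.of_eq ?_)
    simp [List.flatMap_map, leaves]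
  have hnd : (x.leaves ++ l).Nodup := hperm.nodup_iff.1 m.nodup
  have hdisj : ∀ a ∈ l, a ∉ x.leaves := fun a hl hxl =>
    (List.nodup_append.1 hnd).2.2 a hxl a hl rfl
  have hcov : ∀ a, a ∉ x.leaves → a ∈ l := fun a ha =>
    (List.mem_append.1 (hperm.subset (m.mem_leaves a))).resolve_left ha
  let ψ := Fintype.equivFin {a : Fin n // a ∈ x.leaves}
  let φ := Fintype.equivFin (Option {a : Fin n // a ∉ x.leaves})
  -- The value `ψ ⟨i, hi⟩` off the leaves of `x` is a dummy: `g` is only evaluated on leaves of `x`.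
  let g : Fin n → Fin (Fintype.card {a : Fin n // a ∈ x.leaves}) :=
    fun a => if ha : a ∈ x.leaves then ψ ⟨a, ha⟩ else ψ ⟨i, hi⟩
  have hg : ∀ a (ha : a ∈ x.leaves), g a = ψ ⟨a, ha⟩ := fun a ha => dif_pos ha
  have ginj : ∀ a ∈ x.leaves, ∀ b ∈ x.leaves, g a = g b → a = b := by
    intro a ha b hb hab
    rw [hg a ha, hg b hb] at hab
    exact congrArg Subtype.val (ψ.injective hab)
  let k := φ none
  -- The hole `none` becomes the argument `k`. Leaves of `x` also default to `k`, harmlessly, since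
  -- none of them occurs in `c`.
  let u : Option (Fin n) → Fin (Fintype.card (Option {a : Fin n // a ∉ x.leaves})) :=
    fun b => b.elim k fun a => if ha : a ∉ x.leaves then φ (some ⟨a, ha⟩) else k
  have hu : ∀ a (ha : a ∉ x.leaves), u (some a) = φ (some ⟨a, ha⟩) := fun a ha => dif_pos ha
  have huk : ∀ a (ha : a ∉ x.leaves), u (some a) ≠ k := fun a ha hk => by
    rw [hu a ha] at hk
    cases φ.injective hk
  have hcmem : ∀ a, some a ∈ c.leaves → a ∉ x.leaves := fun a ha =>
    hdisj a (by simpa using hc.subset ha)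
  let f : Monomial (Fintype.card {a : Fin n // a ∈ x.leaves}) :=
    { tree := x.relabel g
      nodup := by
        rw [leaves_relabel]
        exact (List.nodup_append.1 hnd).1.map_on fun a ha b hb => ginj a ha b hb
      mem_leaves := fun b => by
        rw [leaves_relabel, List.mem_map]
        exact ⟨ψ.symm b, (ψ.symm b).2, by rw [hg _ (ψ.symm b).2]; simp⟩ }
  let q : Monomial (Fintype.card (Option {a : Fin n // a ∉ x.leaves})) :=
    { tree := c.relabel u
      nodup := by
        rw [leaves_relabel]
        refine List.Nodup.map_on ?_ (hc.nodup_iff.2 ?_)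
        · rintro (_ | a) ha (_ | b) hb hab
          · rfl
          · exact absurd hab.symm (huk b (hcmem b hb))
          · exact absurd hab (huk a (hcmem a ha))
          · rw [hu a (hcmem a ha), hu b (hcmem b hb)] at hab
            simpa using φ.injective hab
        · refine List.nodup_cons.2 ⟨by simp, ?_⟩
          exact (List.nodup_append.1 hnd).2.1.map (Option.some_injective _)
      mem_leaves := fun b => by
        rw [leaves_relabel, List.mem_map]
        obtain ⟨b, rfl⟩ := φ.surjective b
        rcases b with _ | ⟨a, ha⟩
        · exact ⟨none, hc.symm.subset (by simp), rfl⟩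
        · exact ⟨some a, hc.symm.subset (by simpa using hcov a ha), hu a ha⟩ }
  let e₁ : {a : Fin n // a ∉ x.leaves} ≃ {b // b ≠ k} :=
    Equiv.ofBijective (fun a => ⟨φ (some a), fun h => by cases φ.injective h⟩)
      ⟨fun a b hab => Option.some_injective _ (φ.injective (congrArg Subtype.val hab)),
        fun ⟨b, hb⟩ => by
          obtain ⟨b, rfl⟩ := φ.surjective b
          rcases b with _ | a
          · exact absurd rfl hb
          · exact ⟨a, rfl⟩⟩
  -- Undoes both numberings and glues the leaves of `x` to their complement.
  let e := (Equiv.sumComm _ _).trans ((Equiv.sumCongr ψ e₁).symm.trans (Equiv.sumCompl _))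
  have he₁ : ∀ a, e (Sum.inl (e₁ a)) = a := fun a => by simp [e]
  have he₂ : ∀ a ∈ x.leaves, e (Sum.inr (g a)) = a := fun a ha => by rw [hg a ha]; simp [e]
  refine ⟨_, _, q, k, f, e, g i, g j, ?_, ?_, he₂ i hi, he₂ j hj, ?_, ?_⟩
  · obtain ⟨a, ha⟩ := hlt
    simpa using Fintype.card_subtype_lt (p := fun a => a ∈ x.leaves) ha
  · convert h using 1
    change ((c.relabel u).partialComp k (x.relabel g)).relabel e = _
    rw [Tree.relabel, partialComp, subst_subst,
      show c.relabel u = c.subst fun b => leaf (u b) from rfl, subst_subst]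
    refine subst_congr fun b hb => ?_
    rcases b with _ | a
    · change (if h : k = k then _ else _ : Tree _).relabel e = x
      rw [dif_pos rfl, relabel_relabel, relabel_relabel]
      exact relabel_eq_self he₂
    · have ha := hcmem a hb
      change (if h : u (some a) = k then _ else _ : Tree _).relabel e = leaf a
      rw [dif_neg (huk a ha)]
      change leaf (e (Sum.inl ⟨u (some a), huk a ha⟩)) = leaf a
      have hua : (⟨u (some a), huk a ha⟩ : {b // b ≠ k}) = e₁ ⟨a, ha⟩ := Subtype.ext (hu a ha)
      rw [hua, he₁ ⟨a, ha⟩]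
  · exact fun h => hij (ginj i hi j hj h)
  -- Transposing and then numbering agrees with numbering and then transposing, but only on leaves
  -- of `x`, where `g` is injective.
  · have hgx := hx.relabel g
    convert hgx using 1
    change (x.relabel g).relabel _ = (x.relabel _).relabel g
    rw [relabel_relabel, relabel_relabel]
    refine relabel_congr fun a ha => ?_
    simp only [Function.comp_apply, Equiv.swap_apply_def]
    have h₁ : g a = g i ↔ a = i := ⟨ginj a ha i hi, congrArg g⟩
    have h₂ : g a = g j ↔ a = j := ⟨ginj a ha j hj, congrArg g⟩
    simp only [h₁, h₂]
    split_ifs <;> rfl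

/-- The swap fixes `a`, so `i ≠ a` and `i` lies on one side of `a`. That side is congruent to its
own transpose, hence contains `j` as well, and `a` witnesses that it is proper. -/
theorem comesFromFactor_of_splitAt (m : Monomial n) {i j : Fin n} (h : m.CommRel i j) {o : Op}
    {a : Fin n} {p : Option (Tree (Fin n)) × Option (Tree (Fin n))}
    (hp : m.tree.splitAt o a = some p) : m.ComesFromFactor i j := by
  obtain ⟨x, y⟩ := p
  obtain ⟨hij, hm⟩ := h
  obtain ⟨ha, hx, hy⟩ := splitAt_of_diaEq_relabel (Equiv.swap i j).injective hm hp
  have hl := leaves_of_splitAt hp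
  have hnd := m.nodup
  rw [hl, List.nodup_middle, List.nodup_cons, List.mem_append, not_or] at hnd
  have hmem := m.mem_leaves i
  have hai : i ≠ a := by
    rintro rfl
    rw [Equiv.swap_apply_left] at ha
    exact hij ha.symm
  have hj : ∀ {t : Tree (Fin n)}, DIAEq t (t.transpose i j) → i ∈ t.leaves → j ∈ t.leaves := by
    intro t ht hi
    refine ht.leaves_perm.symm.subset ?_
    rw [transpose, leaves_relabel, List.mem_map]
    exact ⟨i, hi, Equiv.swap_apply_left i j⟩
  -- Leaves tagged by `some` are not holes, so filling the hole restores `z`.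
  have hsub : ∀ (t z : Tree (Fin n)),
      (z.relabel some).subst (fun b => b.elim t leaf) = z := fun t z =>
    (subst_subst _ _ z).trans (subst_leaf z)
  rw [hl, List.mem_append, List.mem_cons, or_left_comm] at hmem
  rcases hmem.resolve_left hai with hi | hi
  · rcases x with _ | x
    · cases hi
    have hx' : DIAEq x (x.transpose i j) := optionCoset_some.1 hx
    obtain ⟨z, hz⟩ := exists_assocEq_of_splitAt_fst hp
    refine m.comesFromFactor_of_assocEq_subst hij hi (hj hx' hi) hx' ⟨a, hnd.1.1⟩
      (c := node o (leaf none) (z.relabel some)) (l := z.leaves) ?_ ?_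
    · simp [leaves, leaves_relabel]
    · simpa only [subst, hsub, Option.elim_none] using hz
  · rcases y with _ | y
    · cases hi
    have hy' : DIAEq y (y.transpose i j) := optionCoset_some.1 hy
    obtain ⟨z, hz⟩ := exists_assocEq_of_splitAt_snd hp
    refine m.comesFromFactor_of_assocEq_subst hij hi (hj hy' hi) hy' ⟨a, hnd.1.2⟩
      (c := node o (z.relabel some) (leaf none)) (l := z.leaves) ?_ ?_
    · simp only [leaves, leaves_relabel]
      exact List.perm_append_singleton _ _
    · simpa only [subst, hsub, Option.elim_none] using hz

end Monomial

end DoubleInterchange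

theorem mainTheorem5 (n : ℕ) (m : DoubleInterchange.Monomial n) (i j : Fin n)
    (hcomm : m.CommRel i j)
    (hfactor : ¬ m.ComesFromFactor i j)
    (hquotient : ¬ m.ComesFromQuotient i j) :
    (m.realization.HasHorizontalMainCut ∧ m.realization.HasVerticalMainCut) ∧
      m.InterchangeAtRoot := by
  have hs : ∀ o a, m.tree.splitAt o a = none := fun o a => by
    cases h : m.tree.splitAt o a with
    | none => rfl
    | some p => exact absurd (m.comesFromFactor_of_splitAt hcomm h) hfactor
  refine ⟨⟨DoubleInterchange.Tree.hasHorizontalMainCut_of_splitAt_eq_none (hs .white),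
    DoubleInterchange.Tree.hasVerticalMainCut_of_splitAt_eq_none (hs .black)⟩, ?_⟩
  cases ht : m.tree with
  | leaf b =>
    have := hs .white b
    simp [ht, DoubleInterchange.Tree.splitAt] at this
  | node o l r =>
    -- Only the splitting for the root operation matters here: the children inherit the absence of
    -- leaf factors for `o`.
    have hlr := fun a =>
      DoubleInterchange.Tree.splitAt_node_self_eq_none (ht ▸ hs o a)
    obtain ⟨z₁, z₂, hl⟩ :=
      DoubleInterchange.Tree.exists_interEq_of_splitAt_eq_none fun a => (hlr a).1
    obtain ⟨z₃, z₄, hr⟩ :=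
      DoubleInterchange.Tree.exists_interEq_of_splitAt_eq_none fun a => (hlr a).2
    exact ⟨o, l, r, z₁, z₂, z₃, z₄, ht, hl, hr⟩
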